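/- For a finite group $G$ let $\exp(G)$ be its exponent and put $\varphi(G)=|\{a\in G : o(a)=\exp(G)\}|$, where $o(a)$ is the order of $a$; for a positive integer $n$, $\varphi(n)$ is Euler's totient. Let $M_{11}$ be the Mathieu group of degree $11$, that is, the group of permutations of $\{1,\dots,11\}$ generated by $(1,2,3,4,5,6,7,8,9,10,11)$ and $(3,7,11,8)(4,10,5,6)$, and let $m=\exp(M_{11})$. Then $|M_{11}|=2^4\cdot 3^2\cdot 5\cdot 11$, $330\mid m$, $\exp(\mathbb{Z}_m\times M_{11})=m$, $$|\mathrm{Aut}(\mathbb{Z}_m\times M_{11})|=|\mathrm{Aut}(\mathbb{Z}_m)|\,|M_{11}|=\varphi(m)\,|M_{11}|,$$ and $$\varphi(\mathbb{Z}_m\times M_{11})>|\mathrm{Aut}(\mathbb{Z}_m\times M_{11})|.$$ Consequently it is not true that $\varphi(G)\le|\mathrm{Aut}(G)|$ for every finite group $G$. -/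

import Mathlib

/-- The generalized totient of a group `G`: the number of elements of `G` whose order equals
the exponent of `G`. -/
noncomputable def groupTotient (G : Type*) [Group G] : ℕ :=
  Nat.card {a : G // orderOf a = Monoid.exponent G}

/-- The Mathieu group `M₁₁` in its natural action on eleven points, given by the usual generators
`(1,2,3,4,5,6,7,8,9,10,11)` and `(3,7,11,8)(4,10,5,6)`; the points are numbered `0, …, 10` here. -/
def MathieuM11 : Subgroup (Equiv.Perm (Fin 11)) :=
  Subgroup.closure
    {List.formPerm [0, 1, 2, 3, 4, 5, 6, 7, 8, 9, 10],
      List.formPerm [2, 6, 10, 7] * List.formPerm [3, 9, 4, 5]}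

/-- The exponent `m` of `M₁₁`. -/
noncomputable def expM11 : ℕ := Monoid.exponent MathieuM11

/-- The direct product `ℤ_m × M₁₁`, with `m` the exponent of `M₁₁`; the cyclic group is written
multiplicatively. -/
abbrev CyclicTimesM11 : Type := Multiplicative (ZMod expM11) × MathieuM11

/-! Let `m` be the exponent of `M₁₁`. A pair `(z, g)` with `z` of order `m` has order `m`, which
gives `φ(m)|M₁₁|` elements. As 11 divides `|M₁₁|` exactly once, `m = 11n` with `n` prime to 11, and
an element of order `n` paired with one of order 11 is a further element of order `m`. Conversely
`M₁₁` is perfect, centreless and has only inner automorphisms, so `Aut(ℤ_m × M₁₁)` has order exactly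
`φ(m)|M₁₁|` (`MulAut.card_prod_of_center_trivial`, `conj_surjective`). The order 7920 = 11·10·9·8
comes from sharp four-transitivity: explicit words give transitivity, and invariance of a Steiner
system makes four-point stabilisers trivial (`eq_one_of_fixes`). -/

namespace MathieuM11

open Equiv Finset

/-! ### Generators and the invariant Steiner system -/

/-- The translation `z ↦ z + 1` of `ℤ/11`. -/
def shift : Perm (Fin 11) :=
  ⟨fun z => z + 1, fun z => z - 1, by decide, by decide⟩

/-- The permutation `z ↦ 4 z ^ 2 - 3 z ^ 7` of `ℤ/11`. -/
def quad : Perm (Fin 11) :=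
  ⟨![0, 1, 6, 9, 5, 3, 10, 2, 8, 4, 7], ![0, 1, 7, 5, 9, 4, 2, 10, 8, 3, 6], by decide, by decide⟩

/-- The permutation `z ↦ 3 z` of `ℤ/11`. -/
def scale : Perm (Fin 11) :=
  ⟨fun z => 3 * z, fun z => 4 * z, by decide, by decide⟩

theorem eq_closure : MathieuM11 = Subgroup.closure {shift, quad} := by
  have h₁ : List.formPerm [0, 1, 2, 3, 4, 5, 6, 7, 8, 9, 10] = shift := by
    apply Equiv.ext; decide +kernel
  have h₂ : List.formPerm [2, 6, 10, 7] * List.formPerm [3, 9, 4, 5] = quad := by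
    apply Equiv.ext; decide +kernel
  rw [MathieuM11, h₁, h₂]

theorem shift_mem : shift ∈ MathieuM11 := by
  rw [eq_closure]; exact Subgroup.subset_closure (by simp)

theorem quad_mem : quad ∈ MathieuM11 := by
  rw [eq_closure]; exact Subgroup.subset_closure (by simp)

theorem scale_eq :
    scale = shift ^ 3 * quad ^ 3 * shift ^ 5 * quad ^ 3 * shift ^ 9 * quad ^ 3 := by
  apply Equiv.ext; decide +kernel

theorem scale_mem : scale ∈ MathieuM11 := by
  have ha := pow_mem shift_mem
  have hb := pow_mem quad_mem
  rw [scale_eq]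
  exact mul_mem (mul_mem (mul_mem (mul_mem (mul_mem (ha 3) (hb 3)) (ha 5)) (hb 3)) (ha 9)) (hb 3)

/-- The number whose binary digits form the indicator function of `S`. -/
def encode (S : Finset (Fin 11)) : ℕ := ∑ i ∈ S, 2 ^ (i : ℕ)

/-- The set whose indicator function is given by the binary digits of `n`. -/
def decode (n : ℕ) : Finset (Fin 11) := univ.filter fun i => n.testBit i

theorem encode_injective : Function.Injective encode := by
  intro S T h
  apply Finset.map_injective Fin.valEmbedding
  apply Finset.geomSum_injective le_rfl
  simpa [encode] using h

/-- The codes of the blocks of the Steiner system `S(4, 5, 11)` preserved by `M₁₁`. -/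
def blockCodes : List ℕ :=
  [61, 103, 122, 151, 171, 206, 217, 244, 283, 302, 333, 342, 369, 412, 421, 434, 451, 488, 527,
    566, 595, 604, 617, 666, 684, 689, 709, 738, 789, 803, 824, 842, 868, 902, 905, 976, 1054,
    1075, 1099, 1109, 1132, 1165, 1190, 1208, 1234, 1249, 1287, 1321, 1332, 1368, 1378, 1418,
    1425, 1476, 1561, 1573, 1578, 1606, 1648, 1667, 1684, 1736, 1804, 1810, 1857, 1952]

/-- `S` is a block of the Steiner system `S(4, 5, 11)` preserved by `M₁₁`. -/
def IsBlock (S : Finset (Fin 11)) : Prop := encode S ∈ blockCodes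

instance : DecidablePred IsBlock := fun S => inferInstanceAs (Decidable (encode S ∈ blockCodes))

/-- Reduces invariance to a check of 66 codes instead of all subsets. -/
theorem isBlock_image_of_codes {g : Perm (Fin 11)}
    (h : ∀ n ∈ blockCodes, encode (decode n) = n ∧ IsBlock ((decode n).image g))
    (S : Finset (Fin 11)) (hS : IsBlock S) : IsBlock (S.image g) := by
  obtain ⟨h₁, h₂⟩ := h _ hS
  rwa [encode_injective h₁] at h₂

theorem isBlock_image {g : Perm (Fin 11)} (hg : g ∈ MathieuM11) :
    ∀ S, IsBlock S → IsBlock (S.image g) := by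
  rw [eq_closure] at hg
  induction hg using Subgroup.closure_induction'' with
  | mem x hx =>
    rcases hx with rfl | rfl <;> exact isBlock_image_of_codes (by decide +kernel)
  | inv_mem x hx =>
    rcases hx with rfl | rfl <;> exact isBlock_image_of_codes (by decide +kernel)
  | one => simp
  | mul x y hx hy h₁ h₂ =>
    intro S hS
    have := h₁ _ (h₂ S hS)
    rwa [Finset.image_image, ← Perm.coe_mul] at this

/-- The subsets with three elements of the block `{0, 1, 3, 4, 8}`. -/
def triples : Finset (Finset (Fin 11)) := powersetCard 3 {0, 1, 3, 4, 8}

/-- Two blocks through `x` and `p`, each meeting the base block in a triple, distinguish `x` from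
`y`: a permutation preserving blocks and fixing the base block pointwise cannot send `x` to `y`, as
`v` would be the image of `p`. -/
theorem exists_triples : ∀ x y : Fin 11, x ∉ ({0, 1, 3, 4, 8} : Finset (Fin 11)) → y ≠ x →
    ∃ p, ∃ T ∈ triples, IsBlock (T ∪ {x, p}) ∧ ∃ T' ∈ triples, IsBlock (T' ∪ {x, p}) ∧
      ∀ v, ¬ (IsBlock (T ∪ {y, v}) ∧ IsBlock (T' ∪ {y, v})) := by
  decide +kernel

/-- An element of `M₁₁` that fixes the points `0, 1, 3, 4` is trivial. -/
theorem eq_one_of_fixes {g : Perm (Fin 11)} (hg : g ∈ MathieuM11) (h₀ : g 0 = 0) (h₁ : g 1 = 1)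
    (h₃ : g 3 = 3) (h₄ : g 4 = 4) : g = 1 := by
  -- `{0, 1, 3, 4, 8}` is the only block through the four fixed points.
  have h₈ : g 8 = 8 := by
    have h := isBlock_image hg {0, 1, 3, 4, 8} (by decide +kernel)
    simp only [image_insert, image_singleton, h₀, h₁, h₃, h₄] at h
    exact (by decide +kernel : ∀ v : Fin 11, IsBlock {0, 1, 3, 4, v} → v = 8) _ h
  have hfix : ∀ x ∈ ({0, 1, 3, 4, 8} : Finset (Fin 11)), g x = x := by
    simp [h₀, h₁, h₃, h₄, h₈]
  have himage : ∀ T ∈ triples, ∀ x p, (T ∪ {x, p}).image g = T ∪ {g x, g p} := by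
    intro T hT x p
    have : T.image g = T.image id :=
      image_congr fun z hz => hfix z ((mem_powersetCard.1 hT).1 hz)
    rw [image_union, this, image_id, image_insert, image_singleton]
  ext1 x
  by_cases hx : x ∈ ({0, 1, 3, 4, 8} : Finset (Fin 11))
  · exact hfix x hx
  by_contra hne
  obtain ⟨p, T, hT, hb, T', hT', hb', hv⟩ := exists_triples x (g x) hx hne
  apply hv (g p)
  rw [← himage T hT, ← himage T' hT']
  exact ⟨isBlock_image hg _ hb, isBlock_image hg _ hb'⟩

/-! ### Sharp four-transitivity and the order -/

theorem exists_map_zero : ∀ t : Fin 11, ∃ g ∈ MathieuM11, g 0 = t := by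
  intro t
  have h : ∀ t : Fin 11, ∃ i : Fin 11, (shift ^ (i : ℕ)) 0 = t := by decide +kernel
  obtain ⟨i, hi⟩ := h t
  exact ⟨_, pow_mem shift_mem _, hi⟩

/-- Here and in the next two lemmas, the words fix the earlier base points, and products of their
powers reach every remaining point. -/
theorem exists_map_one {t : Fin 11} (ht : t ≠ 0) : ∃ g ∈ MathieuM11, g 0 = 0 ∧ g 1 = t := by
  have h : ∀ t : Fin 11, t ≠ 0 → ∃ i j : Fin 5,
      (scale ^ (i : ℕ) * (shift * quad ^ 2 * shift ^ 2) ^ (j : ℕ)) 0 = 0 ∧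
      (scale ^ (i : ℕ) * (shift * quad ^ 2 * shift ^ 2) ^ (j : ℕ)) 1 = t := by decide +kernel
  obtain ⟨i, j, hij⟩ := h t ht
  have ha := pow_mem shift_mem
  have hb := pow_mem quad_mem
  exact ⟨_, mul_mem (pow_mem scale_mem _)
    (pow_mem (mul_mem (mul_mem shift_mem (hb 2)) (ha 2)) _), hij⟩

theorem exists_map_three {t : Fin 11} (h₀ : t ≠ 0) (h₁ : t ≠ 1) :
    ∃ g ∈ MathieuM11, g 0 = 0 ∧ g 1 = 1 ∧ g 3 = t := by
  have h : ∀ t : Fin 11, t ≠ 0 → t ≠ 1 → ∃ i j : Fin 4,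
      (quad ^ (i : ℕ) * (shift * quad * shift ^ 5 * quad * shift) ^ (j : ℕ)) 0 = 0 ∧
      (quad ^ (i : ℕ) * (shift * quad * shift ^ 5 * quad * shift) ^ (j : ℕ)) 1 = 1 ∧
      (quad ^ (i : ℕ) * (shift * quad * shift ^ 5 * quad * shift) ^ (j : ℕ)) 3 = t := by
    decide +kernel
  obtain ⟨i, j, hij⟩ := h t h₀ h₁
  have ha := shift_mem
  have hb := quad_mem
  exact ⟨_, mul_mem (pow_mem hb _)
    (pow_mem (mul_mem (mul_mem (mul_mem (mul_mem ha hb) (pow_mem ha 5)) hb) ha) _), hij⟩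

theorem exists_map_four {t : Fin 11} (h₀ : t ≠ 0) (h₁ : t ≠ 1) (h₃ : t ≠ 3) :
    ∃ g ∈ MathieuM11, g 0 = 0 ∧ g 1 = 1 ∧ g 3 = 3 ∧ g 4 = t := by
  let u := shift * quad ^ 2 * shift ^ 6 * quad ^ 3 * shift ^ 2
  let v := shift * quad ^ 2 * shift ^ 8 * quad * shift ^ 4
  have h : ∀ t : Fin 11, t ≠ 0 → t ≠ 1 → t ≠ 3 → ∃ i j : Fin 4,
      (u ^ (i : ℕ) * v ^ (j : ℕ)) 0 = 0 ∧ (u ^ (i : ℕ) * v ^ (j : ℕ)) 1 = 1 ∧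
      (u ^ (i : ℕ) * v ^ (j : ℕ)) 3 = 3 ∧ (u ^ (i : ℕ) * v ^ (j : ℕ)) 4 = t := by
    decide +kernel
  obtain ⟨i, j, hij⟩ := h t h₀ h₁ h₃
  have ha := pow_mem shift_mem
  have hb := pow_mem quad_mem
  have hu : u ∈ MathieuM11 :=
    mul_mem (mul_mem (mul_mem (mul_mem shift_mem (hb 2)) (ha 6)) (hb 3)) (ha 2)
  have hv : v ∈ MathieuM11 :=
    mul_mem (mul_mem (mul_mem (mul_mem shift_mem (hb 2)) (ha 8)) quad_mem) (ha 4)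
  exact ⟨_, mul_mem (pow_mem hu _) (pow_mem hv _), hij⟩

/-- The base points `0, 1, 3, 4` of the sharply four-transitive action of `M₁₁`. -/
def basePoints : Fin 4 ↪ Fin 11 := ⟨![0, 1, 3, 4], by decide⟩

theorem bijective_map_basePoints :
    Function.Bijective fun g : MathieuM11 => basePoints.trans (g : Perm (Fin 11)).toEmbedding := by
  constructor
  · intro g k hgk
    have h : ∀ i, ((k : Perm (Fin 11))⁻¹ * (g : Perm (Fin 11))) (basePoints i) = basePoints i := by
      intro i
      have := DFunLike.congr_fun hgk i
      rw [Perm.mul_apply, Perm.inv_eq_iff_eq]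
      exact this
    have := eq_one_of_fixes (mul_mem (inv_mem k.2) g.2) (h 0) (h 1) (h 2) (h 3)
    exact Subtype.ext (inv_mul_eq_one.1 this).symm
  · intro e
    have hne : ∀ (g : Perm (Fin 11)) {i j : Fin 4} {x : Fin 11}, g x = e i → j ≠ i →
        g⁻¹ (e j) ≠ x := by
      intro g i j x hg hij h
      rw [Perm.inv_eq_iff_eq, hg] at h
      exact hij (e.injective h)
    -- Each new factor fixes the base points already placed and sends the next one to the pullback
    -- of its target; `hne` keeps that pullback off the earlier points.
    obtain ⟨g, hg, hg₀⟩ := exists_map_zero (e 0)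
    obtain ⟨k, hk, hk₀, hk₁⟩ := exists_map_one (hne g hg₀ (by decide : (1 : Fin 4) ≠ 0))
    have h₀ : (g * k) 0 = e 0 := by rw [Perm.mul_apply, hk₀, hg₀]
    have h₁ : (g * k) 1 = e 1 := by rw [Perm.mul_apply, hk₁, ← Perm.inv_eq_iff_eq.1 rfl]
    obtain ⟨l, hl, hl₀, hl₁, hl₃⟩ := exists_map_three
      (hne (g * k) h₀ (by decide : (2 : Fin 4) ≠ 0)) (hne (g * k) h₁ (by decide : (2 : Fin 4) ≠ 1))
    have h₀' : (g * k * l) 0 = e 0 := by rw [Perm.mul_apply, hl₀, h₀]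
    have h₁' : (g * k * l) 1 = e 1 := by rw [Perm.mul_apply, hl₁, h₁]
    have h₃' : (g * k * l) 3 = e 2 := by rw [Perm.mul_apply, hl₃, ← Perm.inv_eq_iff_eq.1 rfl]
    obtain ⟨m, hm, hm₀, hm₁, hm₃, hm₄⟩ := exists_map_four
      (hne (g * k * l) h₀' (by decide : (3 : Fin 4) ≠ 0))
      (hne (g * k * l) h₁' (by decide : (3 : Fin 4) ≠ 1))
      (hne (g * k * l) h₃' (by decide : (3 : Fin 4) ≠ 2))
    refine ⟨⟨g * k * l * m, mul_mem (mul_mem (mul_mem hg hk) hl) hm⟩, ?_⟩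
    ext1 i
    change (g * k * l * m) (basePoints i) = e i
    rw [Perm.mul_apply]
    fin_cases i
    · exact (congrArg _ hm₀).trans h₀'
    · exact (congrArg _ hm₁).trans h₁'
    · exact (congrArg _ hm₃).trans h₃'
    · exact (congrArg _ hm₄).trans (Perm.inv_eq_iff_eq.1 rfl).symm

theorem card_eq : Nat.card MathieuM11 = 7920 := by
  rw [Nat.card_congr (Equiv.ofBijective _ bijective_map_basePoints), Nat.card_eq_fintype_card,
    Fintype.card_embedding_eq]
  rfl

end MathieuM11

/-- In a finite group whose order is exactly divisible by the prime `p`, every element of order `p`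
is conjugate to a power of any given element of order `p`. -/
theorem exists_conj_eq_pow_of_orderOf_eq_prime {G : Type*} [Group G] [Finite G] {p : ℕ}
    [Fact p.Prime] (hp : (Nat.card G).factorization p = 1) {x y : G} (hx : orderOf x = p)
    (hy : orderOf y = p) : ∃ g : G, ∃ k : ℕ, g * y * g⁻¹ = x ^ k := by
  -- Subgroups of order `p` are Sylow here, hence conjugate.
  let P : Sylow p G := Sylow.ofCard (Subgroup.zpowers x) (by rw [Nat.card_zpowers, hx, hp, pow_one])
  let Q : Sylow p G := Sylow.ofCard (Subgroup.zpowers y) (by rw [Nat.card_zpowers, hy, hp, pow_one])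
  obtain ⟨g, hg⟩ := MulAction.exists_smul_eq G Q P
  have hmem : MulAut.conj g y ∈ P := by
    rw [← hg]
    exact Subgroup.smul_mem_pointwise_smul y (MulAut.conj g) (Q : Subgroup G)
      (Subgroup.mem_zpowers y)
  obtain ⟨k, hk⟩ := mem_powers_iff_mem_zpowers.2
    (show MulAut.conj g y ∈ Subgroup.zpowers x from hmem)
  exact ⟨g, k, hk.symm⟩

/-! ### Centralisers, relations, perfectness and centre -/

namespace MathieuM11

open Equiv Finset

/-- Corrected by a power of `shift`, `c` fixes 0, hence every point of the orbit of 0. -/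
theorem commute_shift {c : Perm (Fin 11)} (hc : c ∈ MathieuM11) (h : Commute c shift) :
    ∃ i : Fin 11, c = shift ^ (i : ℕ) := by
  obtain ⟨i, hi⟩ := (by decide +kernel : ∀ t : Fin 11, ∃ i : Fin 11, (shift ^ (i : ℕ)) 0 = t) (c 0)
  have hd : Commute ((shift ^ (i : ℕ))⁻¹ * c) shift :=
    ((Commute.refl shift).pow_left _).inv_left.mul_left h
  have h₀ : ((shift ^ (i : ℕ))⁻¹ * c) 0 = 0 := by
    rw [Perm.mul_apply, Perm.inv_eq_iff_eq, hi]
  have hn : ∀ n : ℕ, ((shift ^ (i : ℕ))⁻¹ * c) ((shift ^ n) 0) = (shift ^ n) 0 := by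
    intro n
    rw [← Perm.mul_apply, (hd.pow_right n).eq, Perm.mul_apply, h₀]
  have := eq_one_of_fixes (mul_mem (inv_mem (pow_mem shift_mem _)) hc) h₀ (hn 1) (hn 3) (hn 4)
  exact ⟨i, (inv_mul_eq_one.1 this).symm⟩

/-- The orbits of `scale` are 0, the squares and the nonsquares. If `c` preserves the squares, a
power of `scale` corrects it to fix 0, 1, 3, 4; it cannot swap the two sets, since the nonsquares
form a block and the squares do not. -/
theorem commute_scale {c : Perm (Fin 11)} (hc : c ∈ MathieuM11) (h : Commute c scale) :
    ∃ i : Fin 5, c = scale ^ (i : ℕ) := by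
  have happ : ∀ {d : Perm (Fin 11)}, Commute d scale → ∀ (n : ℕ) (x : Fin 11),
      d ((scale ^ n) x) = (scale ^ n) (d x) := by
    intro d hd n x
    rw [← Perm.mul_apply, (hd.pow_right n).eq, Perm.mul_apply]
  have hc₀ : c 0 = 0 :=
    (by decide +kernel : ∀ x : Fin 11, x = (scale ^ 1) x → x = 0) _ (happ h 1 0)
  have hc₁ : c 1 ≠ 0 := fun h₁ => by
    have := c.injective (h₁.trans hc₀.symm)
    revert this; decide
  by_cases hsq : ∃ i : Fin 5, (scale ^ (i : ℕ)) 1 = c 1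
  · obtain ⟨i, hi⟩ := hsq
    have hd : Commute ((scale ^ (i : ℕ))⁻¹ * c) scale :=
      ((Commute.refl scale).pow_left _).inv_left.mul_left h
    have h₀ : ((scale ^ (i : ℕ))⁻¹ * c) 0 = 0 := by
      rw [Perm.mul_apply, Perm.inv_eq_iff_eq, hc₀]
      exact (by decide +kernel : ∀ i : Fin 5, 0 = (scale ^ (i : ℕ)) 0) i
    have h₁ : ((scale ^ (i : ℕ))⁻¹ * c) 1 = 1 := by
      rw [Perm.mul_apply, Perm.inv_eq_iff_eq, hi]
    have hn : ∀ n : ℕ, ((scale ^ (i : ℕ))⁻¹ * c) ((scale ^ n) 1) = (scale ^ n) 1 := by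
      intro n
      rw [happ hd, h₁]
    have := eq_one_of_fixes (mul_mem (inv_mem (pow_mem scale_mem _)) hc) h₀ h₁ (hn 1) (hn 4)
    exact ⟨i, (inv_mul_eq_one.1 this).symm⟩
  · exfalso
    have himage : ({1, 3, 9, 5, 4} : Finset (Fin 11)).image c = {2, 6, 7, 8, 10} := by
      have h₃ : c 3 = (scale ^ 1) (c 1) := happ h 1 1
      have h₉ : c 9 = (scale ^ 2) (c 1) := happ h 2 1
      have h₅ : c 5 = (scale ^ 3) (c 1) := happ h 3 1
      have h₄ : c 4 = (scale ^ 4) (c 1) := happ h 4 1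
      simp only [image_insert, image_singleton, h₃, h₉, h₅, h₄]
      exact (by decide +kernel : ∀ u : Fin 11, u ≠ 0 → (¬ ∃ i : Fin 5, (scale ^ (i : ℕ)) 1 = u) →
        ({u, (scale ^ 1) u, (scale ^ 2) u, (scale ^ 3) u, (scale ^ 4) u} : Finset (Fin 11)) =
          {2, 6, 7, 8, 10}) _ hc₁ hsq
    have hb := isBlock_image (inv_mem hc) {2, 6, 7, 8, 10} (by decide +kernel)
    rw [← himage, image_image, ← Perm.coe_mul, inv_mul_cancel, Perm.coe_one, image_id] at hb
    revert hb
    decide +kernel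

/-- The translation `z ↦ z + 1`, as an element of `M₁₁`. -/
def shiftM : MathieuM11 := ⟨shift, shift_mem⟩

/-- The permutation `z ↦ 4 z ^ 2 - 3 z ^ 7`, as an element of `M₁₁`. -/
def quadM : MathieuM11 := ⟨quad, quad_mem⟩

/-- The permutation `z ↦ 3 z`, as an element of `M₁₁`. -/
def scaleM : MathieuM11 := ⟨scale, scale_mem⟩

theorem shiftM_pow_eleven : shiftM ^ 11 = 1 := by
  apply Subtype.ext; apply Equiv.ext; decide +kernel

theorem quadM_pow_four : quadM ^ 4 = 1 := by
  apply Subtype.ext; apply Equiv.ext; decide +kernel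

theorem orderOf_shiftM : orderOf shiftM = 11 :=
  have : Fact (Nat.Prime 11) := ⟨by norm_num⟩
  orderOf_eq_prime shiftM_pow_eleven fun h => by
    have : shift 0 = 0 := by rw [show shift = 1 from congrArg Subtype.val h]; rfl
    revert this; decide

theorem scaleM_mul_shiftM : scaleM * shiftM = shiftM ^ 3 * scaleM := by
  apply Subtype.ext; apply Equiv.ext; decide +kernel

theorem quadM_mul_scaleM : quadM * scaleM = scaleM ^ 2 * quadM := by
  apply Subtype.ext; apply Equiv.ext; decide +kernel

theorem shiftM_mul_quadM_pow : (shiftM * quadM) ^ 11 = 1 := by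
  apply Subtype.ext; apply Equiv.ext; decide +kernel

theorem shiftM_mul_quadM_sq_pow : (shiftM * quadM ^ 2) ^ 3 = 1 := by
  apply Subtype.ext; apply Equiv.ext; decide +kernel

theorem commute_shiftM {c : MathieuM11} (h : Commute c shiftM) :
    ∃ i : Fin 11, c = shiftM ^ (i : ℕ) := by
  obtain ⟨i, hi⟩ := commute_shift c.2 (congrArg Subtype.val h : _)
  exact ⟨i, Subtype.ext hi⟩

theorem commute_scaleM {c : MathieuM11} (h : Commute c scaleM) :
    ∃ i : Fin 5, c = scaleM ^ (i : ℕ) := by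
  obtain ⟨i, hi⟩ := commute_scale c.2 (congrArg Subtype.val h : _)
  exact ⟨i, Subtype.ext hi⟩

theorem closure_eq_top : Subgroup.closure {shiftM, quadM} = (⊤ : Subgroup MathieuM11) := by
  apply Subgroup.map_injective MathieuM11.subtype_injective
  rw [MonoidHom.map_closure, ← MonoidHom.range_eq_map, Subgroup.range_subtype, Set.image_pair]
  exact eq_closure.symm

theorem hom_ext {H : Type*} [Group H] {f f' : MathieuM11 →* H} (ha : f shiftM = f' shiftM)
    (hb : f quadM = f' quadM) : f = f' := by
  apply MonoidHom.eq_of_eqOn_dense closure_eq_top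
  rintro x (rfl | rfl)
  exacts [ha, hb]

/-- `M₁₁` is perfect. -/
theorem hom_eq_one {A : Type*} [CommGroup A] (f : MathieuM11 →* A) : f = 1 := by
  have ha : f shiftM = 1 := by
    -- In an abelian image `a = a ^ 3`, so `a ^ 2 = 1 = a ^ 11`.
    have h₁ := congrArg f scaleM_mul_shiftM
    have h₂ := congrArg f shiftM_pow_eleven
    simp only [map_mul, map_pow, map_one] at h₁ h₂
    rw [mul_comm, mul_left_inj] at h₁
    have h₃ : f shiftM ^ 2 = 1 := by
      rw [pow_succ, eq_comm, mul_eq_right] at h₁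
      exact h₁
    have h₄ : f shiftM ^ 10 = 1 := by rw [show 10 = 2 * 5 from rfl, pow_mul, h₃, one_pow]
    rwa [pow_succ, h₄, one_mul] at h₂
  have hb : f quadM = 1 := by
    have h₁ := congrArg f shiftM_mul_quadM_pow
    have h₂ := congrArg f quadM_pow_four
    simp only [map_mul, map_pow, map_one, ha, one_mul] at h₁ h₂
    have h₃ : f quadM ^ 12 = 1 := by rw [show 12 = 4 * 3 from rfl, pow_mul, h₂, one_pow]
    rwa [pow_succ, h₁, one_mul] at h₃
  exact hom_ext ha hb

/-- A central element is a power of `scaleM`, and only the trivial power commutes with `quadM`. -/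
theorem eq_one_of_mem_center {c : MathieuM11} (hc : ∀ g, Commute c g) : c = 1 := by
  obtain ⟨i, rfl⟩ := commute_scaleM (hc scaleM)
  have h : (quadM * scaleM ^ (i : ℕ)) = scaleM ^ (i : ℕ) * quadM := ((hc quadM).eq).symm
  have hi : i = 0 := (by decide +kernel : ∀ i : Fin 5,
    (∀ x, (quad * scale ^ (i : ℕ)) x = (scale ^ (i : ℕ) * quad) x) → i = 0) i
      (Equiv.ext_iff.1 (congrArg Subtype.val h))
  rw [hi]
  rfl

theorem conj_injective : Function.Injective (MulAut.conj : MathieuM11 →* MulAut MathieuM11) := by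
  rw [injective_iff_map_eq_one]
  intro c hc
  apply eq_one_of_mem_center
  intro g
  have := DFunLike.congr_fun hc g
  rw [MulAut.conj_apply, mul_inv_eq_iff_eq_mul] at this
  exact this

instance : Fact (Nat.Prime 11) := ⟨by norm_num⟩

theorem factorization_card : (Nat.card MathieuM11).factorization 11 = 1 := by
  rw [card_eq, Nat.factorization_def _ (Fact.out : Nat.Prime 11), show 7920 = 11 ^ 1 * 720 from rfl,
    padicValNat_base_pow_mul] <;> norm_num

/-! ### Automorphisms are inner -/

theorem exists_conj_map_shiftM (φ : MulAut MathieuM11) :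
    ∃ g : MathieuM11, ∃ k : ℕ, (MulAut.conj g * φ) shiftM = shiftM ^ k :=
  exists_conj_eq_pow_of_orderOf_eq_prime factorization_card orderOf_shiftM
    ((orderOf_injective φ.toMonoidHom φ.injective shiftM).trans orderOf_shiftM)

/-- Both `scaleM` and its image conjugate `shiftM ^ k` to its cube, so they differ by an element
centralising `shiftM`, that is, by a power of it. -/
theorem exists_conj_map_scaleM {φ : MulAut MathieuM11} {k : ℕ} (hφ : φ shiftM = shiftM ^ k) :
    ∃ g : MathieuM11, (MulAut.conj g * φ) shiftM = shiftM ^ k ∧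
      (MulAut.conj g * φ) scaleM = scaleM := by
  have hk : k.Coprime (orderOf shiftM) := by
    rw [orderOf_shiftM, Nat.coprime_comm, Nat.Prime.coprime_iff_not_dvd Fact.out]
    intro h
    rw [← orderOf_shiftM, orderOf_dvd_iff_pow_eq_one, ← hφ, EmbeddingLike.map_eq_one_iff,
      ← orderOf_eq_one_iff, orderOf_shiftM] at h
    omega
  obtain ⟨m, hm⟩ := exists_pow_eq_self_of_coprime hk
  have hcomm : Commute (scaleM⁻¹ * φ scaleM) (shiftM ^ k) := by
    have h₁ : φ scaleM * shiftM ^ k = (shiftM ^ k) ^ 3 * φ scaleM := by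
      rw [← hφ, ← map_mul, scaleM_mul_shiftM, map_mul, map_pow]
    have h₂ : scaleM * shiftM ^ k = (shiftM ^ k) ^ 3 * scaleM := by
      have : SemiconjBy scaleM shiftM (shiftM ^ 3) := scaleM_mul_shiftM
      rw [pow_right_comm]
      exact this.pow_right k
    change _ * _ = _ * _
    rw [mul_assoc, h₁, inv_mul_eq_iff_eq_mul, ← mul_assoc, ← mul_assoc, h₂]
    group
  obtain ⟨j, hj⟩ := commute_shiftM (hm ▸ hcomm.pow_right m)
  rw [inv_mul_eq_iff_eq_mul] at hj
  -- The exponent `a = 7j` solves `3a + j = 0` modulo 11.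
  refine ⟨shiftM ^ (7 * (j : ℕ)), ?_, ?_⟩
  · rw [MulAut.mul_apply, hφ, MulAut.conj_apply, mul_inv_eq_iff_eq_mul, ← pow_add, ← pow_add,
      add_comm]
  · rw [MulAut.mul_apply, hj, MulAut.conj_apply, mul_inv_eq_iff_eq_mul]
    apply Subtype.ext
    apply Equiv.ext
    exact (by decide +kernel : ∀ (j : Fin 11) (x : Fin 11),
      (shift ^ (7 * (j : ℕ)) * (scale * shift ^ (j : ℕ))) x =
        (scale * shift ^ (7 * (j : ℕ))) x) j

/-- The same argument one level up: `quadM` and its image both conjugate `scaleM` to its square.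
Conjugating by powers of `scaleM` keeps the group generated by `shiftM` invariant. -/
theorem exists_conj_map_quadM {φ : MulAut MathieuM11} {k : ℕ} (hφ : φ shiftM = shiftM ^ k)
    (hφ' : φ scaleM = scaleM) :
    ∃ g : MathieuM11, ∃ l : ℕ, (MulAut.conj g * φ) shiftM = shiftM ^ l ∧
      (MulAut.conj g * φ) quadM = quadM := by
  have hcomm : Commute (quadM⁻¹ * φ quadM) scaleM := by
    have h₁ : φ quadM * scaleM = scaleM ^ 2 * φ quadM := by
      conv_lhs => rw [← hφ', ← map_mul, quadM_mul_scaleM, map_mul, map_pow, hφ']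
    change _ * _ = _ * _
    rw [mul_assoc, h₁, inv_mul_eq_iff_eq_mul, ← mul_assoc, ← mul_assoc, quadM_mul_scaleM]
    group
  obtain ⟨i, hi⟩ := commute_scaleM hcomm
  rw [inv_mul_eq_iff_eq_mul] at hi
  have hs : ∀ n : ℕ, SemiconjBy (scaleM ^ n) shiftM (shiftM ^ 3 ^ n) := by
    intro n
    induction n with
    | zero => simp
    | succ n ih =>
      have h : SemiconjBy scaleM shiftM (shiftM ^ 3) := scaleM_mul_shiftM
      rw [pow_succ, pow_succ, pow_mul]
      exact (ih.pow_right 3).mul_left h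
  -- The exponent `a = 2i` solves `2a + i = 0` modulo 5.
  refine ⟨scaleM ^ (2 * (i : ℕ)), 3 ^ (2 * (i : ℕ)) * k, ?_, ?_⟩
  · rw [MulAut.mul_apply, hφ, MulAut.conj_apply, mul_inv_eq_iff_eq_mul, pow_mul shiftM]
    exact (hs _).pow_right k
  · rw [MulAut.mul_apply, hi, MulAut.conj_apply, mul_inv_eq_iff_eq_mul]
    apply Subtype.ext
    apply Equiv.ext
    exact (by decide +kernel : ∀ (j : Fin 5) (x : Fin 11),
      (scale ^ (2 * (j : ℕ)) * (quad * scale ^ (j : ℕ))) x =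
        (quad * scale ^ (2 * (j : ℕ))) x) i

/-- The automorphism preserves two relations between the generators, and these hold for `shiftM ^ k`
only when `k` is 1 modulo 11. -/
theorem eq_one_of_map_shiftM {φ : MulAut MathieuM11} {k : ℕ} (ha : φ shiftM = shiftM ^ k)
    (hb : φ quadM = quadM) : φ = 1 := by
  have hmod : shiftM ^ k = shiftM ^ (k % 11) := by
    have := pow_mod_orderOf shiftM k
    rw [orderOf_shiftM] at this
    exact this.symm
  have h₁ := congrArg φ shiftM_mul_quadM_pow
  have h₂ := congrArg φ shiftM_mul_quadM_sq_pow
  rw [map_pow, map_mul, ha, hb, map_one, hmod] at h₁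
  rw [map_pow, map_mul, map_pow, ha, hb, map_one, hmod] at h₂
  have hk : (⟨k % 11, Nat.mod_lt _ (by norm_num)⟩ : Fin 11) = 1 :=
    (by decide +kernel : ∀ k : Fin 11, (∀ x, ((shift ^ (k : ℕ) * quad) ^ 11) x = x) →
      (∀ x, ((shift ^ (k : ℕ) * quad ^ 2) ^ 3) x = x) → k = 1) _
      (Equiv.ext_iff.1 (congrArg Subtype.val h₁)) (Equiv.ext_iff.1 (congrArg Subtype.val h₂))
  have hk' : k % 11 = 1 := congrArg Fin.val hk
  rw [hmod, hk', pow_one] at ha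
  have : φ.toMonoidHom = MonoidHom.id MathieuM11 := hom_ext ha hb
  ext1 x
  exact DFunLike.congr_fun this x

/-- Every automorphism of `M₁₁` is inner. -/
theorem conj_surjective : Function.Surjective (MulAut.conj : MathieuM11 →* MulAut MathieuM11) := by
  intro φ
  obtain ⟨g, k, hg⟩ := exists_conj_map_shiftM φ
  obtain ⟨g', hg', hs⟩ := exists_conj_map_scaleM hg
  obtain ⟨g'', l, ha, hb⟩ := exists_conj_map_quadM hg' hs
  have h := eq_one_of_map_shiftM ha hb
  rw [← mul_assoc, ← mul_assoc, ← map_mul, ← map_mul, mul_eq_one_iff_inv_eq, ← map_inv] at h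
  exact ⟨_, h⟩

theorem card_mulAut : Nat.card (MulAut MathieuM11) = Nat.card MathieuM11 :=
  (Nat.card_congr (Equiv.ofBijective _ ⟨conj_injective, conj_surjective⟩)).symm

end MathieuM11

/-! ### Automorphisms of a direct product -/

/-- If `G` has trivial centre and no nontrivial homomorphism to the commutative group `Z`, then every
automorphism of `Z × G` is a product of automorphisms of `Z` and `G`. -/
theorem MulAut.card_prod_of_center_trivial {Z G : Type*} [CommGroup Z] [Group G]
    (hcenter : ∀ c : G, (∀ g, Commute c g) → c = 1) (hhom : ∀ f : G →* Z, f = 1) :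
    Nat.card (MulAut (Z × G)) = Nat.card (MulAut Z) * Nat.card (MulAut G) := by
  have hfst : ∀ (φ : MulAut (Z × G)) (g : G), (φ (1, g)).1 = 1 := fun φ g =>
    DFunLike.congr_fun
      (hhom ((MonoidHom.fst Z G).comp (φ.toMonoidHom.comp (MonoidHom.inr Z G)))) g
  -- `(z, 1)` is central, so its image is central and has central second component.
  have hsnd : ∀ (φ : MulAut (Z × G)) (z : Z), (φ (z, 1)).2 = 1 := by
    intro φ z
    apply hcenter
    intro g
    have h : Commute (z, (1 : G)) (φ.symm (1, g)) :=
      Prod.ext (mul_comm _ _) ((Commute.one_left _).eq)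
    have := congrArg Prod.snd (h.map φ).eq
    simpa [commute_iff_eq] using this
  have hleft : ∀ (φ : MulAut (Z × G)) (z : Z), φ (z, 1) = ((φ (z, 1)).1, 1) :=
    fun φ z => Prod.ext rfl (hsnd φ z)
  have hright : ∀ (φ : MulAut (Z × G)) (g : G), φ (1, g) = (1, (φ (1, g)).2) :=
    fun φ g => Prod.ext (hfst φ g) rfl
  rw [← Nat.card_prod]
  refine (Nat.card_congr (Equiv.ofBijective
    (fun p : MulAut Z × MulAut G => (MulEquiv.prodCongr p.1 p.2 : MulAut (Z × G))) ⟨?_, ?_⟩)).symm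
  · rintro ⟨α, β⟩ ⟨α', β'⟩ h
    refine Prod.ext (MulEquiv.ext fun z => ?_) (MulEquiv.ext fun g => ?_)
    · exact congrArg Prod.fst (DFunLike.congr_fun h (z, 1))
    · exact congrArg Prod.snd (DFunLike.congr_fun h (1, g))
  · intro φ
    refine ⟨⟨⟨⟨fun z => (φ (z, 1)).1, fun z => (φ.symm (z, 1)).1, ?_, ?_⟩, ?_⟩,
      ⟨⟨fun g => (φ (1, g)).2, fun g => (φ.symm (1, g)).2, ?_, ?_⟩, ?_⟩⟩, ?_⟩
    · intro z
      change (φ.symm ((φ (z, 1)).1, 1)).1 = z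
      rw [← hleft, MulEquiv.symm_apply_apply]
    · intro z
      change (φ ((φ.symm (z, 1)).1, 1)).1 = z
      rw [← hleft φ.symm, MulEquiv.apply_symm_apply]
    · intro z z'
      change (φ (z * z', 1)).1 = (φ (z, 1)).1 * (φ (z', 1)).1
      rw [← Prod.fst_mul, ← map_mul, Prod.mk_mul_mk, one_mul]
    · intro g
      change (φ.symm (1, (φ (1, g)).2)).2 = g
      rw [← hright, MulEquiv.symm_apply_apply]
    · intro g
      change (φ (1, (φ.symm (1, g)).2)).2 = g
      rw [← hright φ.symm, MulEquiv.apply_symm_apply]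
    · intro g g'
      change (φ (1, g * g')).2 = (φ (1, g)).2 * (φ (1, g')).2
      rw [← Prod.snd_mul, ← map_mul, Prod.mk_mul_mk, one_mul]
    · ext1 ⟨z, g⟩
      change ((φ (z, 1)).1, (φ (1, g)).2) = φ (z, g)
      have : (z, g) = (z, 1) * (1, g) := by simp
      rw [this, map_mul, hleft φ z, hright φ g]
      simp

/-! ### The exponent and the count -/

namespace MathieuM11

theorem expM11_dvd_card : expM11 ∣ 7920 := by
  rw [← card_eq]
  exact Group.exponent_dvd_nat_card

theorem expM11_pos : 0 < expM11 := Nat.pos_of_dvd_of_pos expM11_dvd_card (by norm_num)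

theorem dvd_expM11_of_prime {p : ℕ} (hp : p.Prime) (h : p ∣ 7920) : p ∣ expM11 := by
  rw [← card_eq] at h
  have : Fact p.Prime := ⟨hp⟩
  obtain ⟨g, hg⟩ := exists_prime_orderOf_dvd_card' p h
  rw [← hg]
  exact Monoid.order_dvd_exponent g

theorem dvd_expM11 : 330 ∣ expM11 := by
  have h₂ : 2 ∣ expM11 := dvd_expM11_of_prime (by norm_num) (by norm_num)
  have h₃ : 3 ∣ expM11 := dvd_expM11_of_prime (by norm_num) (by norm_num)
  have h₅ : 5 ∣ expM11 := dvd_expM11_of_prime (by norm_num) (by norm_num)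
  have h₁₁ : 11 ∣ expM11 := dvd_expM11_of_prime (by norm_num) (by norm_num)
  omega

instance : NeZero expM11 := ⟨expM11_pos.ne'⟩

theorem exponent_cyclicTimesM11 : Monoid.exponent CyclicTimesM11 = expM11 := by
  have : Monoid.exponent (Multiplicative (ZMod expM11)) = expM11 := by
    rw [IsCyclic.exponent_eq_card]
    simp
  rw [Monoid.exponent_prod, this]
  exact lcm_same .. |>.trans (normalize_eq _)

theorem card_mulAut_cyclic :
    Nat.card (MulAut (Multiplicative (ZMod expM11))) = Nat.totient expM11 := by
  rw [IsCyclic.card_mulAut]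
  simp

theorem card_mulAut_cyclicTimesM11 :
    Nat.card (MulAut CyclicTimesM11) =
      Nat.card (MulAut (Multiplicative (ZMod expM11))) * Nat.card MathieuM11 := by
  rw [MulAut.card_prod_of_center_trivial (fun _ => eq_one_of_mem_center) hom_eq_one, card_mulAut]

theorem orderOf_dvd_expM11 (g : MathieuM11) : orderOf g ∣ expM11 := Monoid.order_dvd_exponent g

/-- There is an element of order `expM11` whose cyclic component does not have that order. -/
theorem exists_orderOf_eq : ∃ x : CyclicTimesM11, orderOf x = expM11 ∧ orderOf x.1 ≠ expM11 := by
  obtain ⟨n, hn⟩ : 11 ∣ expM11 := dvd_trans (by norm_num) dvd_expM11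
  have hpos := expM11_pos
  -- Otherwise 121 would divide 7920.
  have hcop : n.Coprime 11 := by
    rw [Nat.coprime_comm, Nat.Prime.coprime_iff_not_dvd (by norm_num)]
    rintro ⟨k, rfl⟩
    have h := expM11_dvd_card
    rw [hn] at h
    have : 121 ∣ 7920 := dvd_trans ⟨k, by ring⟩ h
    omega
  -- The order of 11 in `ℤ_m` is `m / gcd(m, 11) = n`.
  have hz : orderOf (Multiplicative.ofAdd (11 : ZMod expM11)) = n := by
    rw [orderOf_ofAdd_eq_addOrderOf]
    have := ZMod.addOrderOf_coe 11 (n := expM11) hpos.ne'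
    rw [Nat.cast_ofNat] at this
    rw [this, hn, Nat.gcd_mul_right_left, Nat.mul_div_cancel_left _ (by norm_num)]
  refine ⟨(Multiplicative.ofAdd 11, shiftM), ?_, ?_⟩
  · rw [Prod.orderOf, hz, orderOf_shiftM, hcop.lcm_eq_mul, hn, mul_comm]
  · rw [hz]
    omega

theorem totient_mul_card_lt_groupTotient :
    Nat.totient expM11 * Nat.card MathieuM11 < groupTotient CyclicTimesM11 := by
  have hcard : Nat.card {z : Multiplicative (ZMod expM11) // orderOf z = expM11} =
      Nat.totient expM11 := by
    rw [Nat.card_eq_fintype_card, Fintype.card_subtype]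
    exact IsCyclic.card_orderOf_eq_totient (by simp)
  obtain ⟨y, hy, hy'⟩ := exists_orderOf_eq
  have hlcm : ∀ x : CyclicTimesM11, orderOf x.1 = expM11 → orderOf x = expM11 := by
    intro x hx
    rw [Prod.orderOf, hx, Nat.lcm_eq_left (orderOf_dvd_expM11 _)]
  rw [groupTotient, exponent_cyclicTimesM11, ← hcard, ← Nat.card_prod]
  have hlt : {x : CyclicTimesM11 | orderOf x.1 = expM11} ⊂
      {x : CyclicTimesM11 | orderOf x = expM11} :=
    Set.ssubset_iff_exists.2 ⟨hlcm, y, hy, hy'⟩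
  refine lt_of_eq_of_lt ?_ (Set.ncard_lt_ncard hlt (Set.toFinite _))
  exact Nat.card_congr (Equiv.prodSubtypeFstEquivSubtypeProd
    (p := fun z : Multiplicative (ZMod expM11) => orderOf z = expM11)).symm

end MathieuM11

theorem mainTheorem11 :
    Nat.card MathieuM11 = 2 ^ 4 * 3 ^ 2 * 5 * 11 ∧
    330 ∣ expM11 ∧
    Monoid.exponent CyclicTimesM11 = expM11 ∧
    Nat.card (MulAut CyclicTimesM11) =
      Nat.card (MulAut (Multiplicative (ZMod expM11))) * Nat.card MathieuM11 ∧
    Nat.card (MulAut CyclicTimesM11) = Nat.totient expM11 * Nat.card MathieuM11 ∧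
    groupTotient CyclicTimesM11 > Nat.card (MulAut CyclicTimesM11) ∧
    ¬ ∀ (G : Type) [Group G] [Finite G], groupTotient G ≤ Nat.card (MulAut G) := by
  have haut := MathieuM11.card_mulAut_cyclicTimesM11
  have haut' : Nat.card (MulAut CyclicTimesM11) = Nat.totient expM11 * Nat.card MathieuM11 := by
    rw [haut, MathieuM11.card_mulAut_cyclic]
  have hlt : Nat.card (MulAut CyclicTimesM11) < groupTotient CyclicTimesM11 :=
    haut' ▸ MathieuM11.totient_mul_card_lt_groupTotient
  exact ⟨MathieuM11.card_eq, MathieuM11.dvd_expM11, MathieuM11.exponent_cyclicTimesM11, haut, haut',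
    hlt, fun h => (h CyclicTimesM11).not_gt hlt⟩
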